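/- An o-graph is a 4-valent graph with an embedding in the plane of a neighbourhood of each vertex, two opposite strands being marked as passing over the other two, and with a colour in $\mathbb{Z}/3$ on each edge. It defines a standard polyhedron $P$ as follows. A neighbourhood of each vertex in $P$ is a horizontal disc together with a vertical half-disc above the overstrand and a vertical half-disc below the understrand, so that three sheets arrive along each edge-end. Along an edge of colour $c$ the three sheets at one end are glued to the three sheets at the other end, respecting their cyclic order around the edge: colour $0$ matches the vertical sheet with the vertical sheet, and colour $c$ composes this matching with $c$ thirds of a full clockwise turn, as seen looking along the edge (the direction of travel does not matter). Finally a disc is glued to each boundary circle of the object so obtained. If $S(P)\subset P$ denotes the graph, the faces of $P$ are the connected components of $P\setminus S(P)$. For $n\geqslant 1$ and $(\alpha_1,\beta_1),\ldots,(\alpha_n,\beta_n)\in(\mathbb{Z}/3)^2$, consider the o-graph based on the closed chain: the vertices $v_1,\ldots,v_n$ are cyclically ordered and drawn as the $n$ crossings of a closed two-strand braid in an annulus, all crossings having the same sign, and consecutive vertices $v_i,v_{i+1}$ (indices modulo $n$) are joined by two edges, of colour $\alpha_i$ on one side of the chain and $\beta_i$ on the other side. The sign of the crossings is the one for which, if the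 chain is drawn locally from left to right, the strand going from top left to bottom right is the overstrand. Proposition. Fix $(\alpha_1,\beta_1)\in\{(0,0),(0,1),(1,0),(1,1)\}$. Then there is $N$ such that for every $n\geqslant N$ the following holds: if $(\alpha_2,\beta_2)\cdots(\alpha_n,\beta_n)$ is a uniformly random word of length $n-1$ in the four letters $(0,2),(1,2),(2,0),(2,1)$, then the standard polyhedron defined by the closed chain o-graph with these colours has exactly one face with probability exactly $1/2$. -/

import Mathlib

open scoped unitInterval

/-- An o-graph on the vertex set `V`. Around each vertex the four edge-ends are labelled by
`Fin 4` in counterclockwise order (for the planar structure at that vertex), in such a way that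
the strand `{0, 2}` passes over the strand `{1, 3}`. An edge of the graph is a pair of edge-ends
exchanged by `mate`, and it carries a colour in `ℤ/3`. -/
structure OGraph (V : Type) where
  mate : V × Fin 4 → V × Fin 4
  mate_mate : ∀ h, mate (mate h) = h
  mate_ne : ∀ h, mate h ≠ h
  colour : V × Fin 4 → ZMod 3
  colour_mate : ∀ h, colour (mate h) = colour h

/-- The regular neighbourhood of a vertex is a horizontal disc together with a vertical half-disc
above the overstrand and a vertical half-disc below the understrand. It consists of six sectors,
one for each pair of distinct edge-ends `{k, l}` at the vertex: the sectors `{k, k + 1}` are the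
four horizontal quadrants, and `{0, 2}`, `{1, 3}` are the upper and lower vertical half-discs.
`Sector V` is the type of sectors with a chosen first side `k`. -/
structure Sector (V : Type) where
  vertex : V
  fst : Fin 4
  snd : Fin 4
  ne : fst ≠ snd

/-- Along the edge-end `k` there are three sheets, namely the sectors `{k, l}` with `l ≠ k`.
Looking outwards from the vertex along `k`, they are, in clockwise order: left, up, right if `k`
belongs to the overstrand; right, down, left if `k` belongs to the understrand. Here left is
`l = k + 1`, right is `l = k + 3`, and the vertical sheet is `l = k + 2`. Positions are
numbered clockwise, modulo 3, the vertical sheet having position `0`. -/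
def sheetPosition (k l : Fin 4) : ZMod 3 :=
  if l = k + 2 then 0
  else if k = 0 ∨ k = 2 then (if l = k + 1 then -1 else 1)
  else (if l = k + 1 then 1 else -1)

namespace OGraph

variable {V : Type}

/-- Each sector is a square `I × I` having the vertex at `(0, 0)`, the half of the first edge along
`I × {0}` and the half of the second edge along `{0} × I`. The side `{1} × I` lies over the
midpoint of the first edge, the side `I × {1}` over the midpoint of the second edge. -/
abbrev Pieces (V : Type) : Type := Σ _ : Sector V, I × I

/-- The gluing of the sectors prescribed by an o-graph. -/
inductive Glue (Γ : OGraph V) : Pieces V → Pieces V → Prop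
  /-- The two ways of ordering the sides of a sector give the same sector. -/
  | swap (v : V) (k l : Fin 4) (h : k ≠ l) (s t : I) :
      Glue Γ ⟨⟨v, k, l, h⟩, (s, t)⟩ ⟨⟨v, l, k, h.symm⟩, (t, s)⟩
  /-- The three sectors incident to an edge-end share the corresponding half-edge. -/
  | halfEdge (v : V) (k l l' : Fin 4) (h : k ≠ l) (h' : k ≠ l') (s : I) :
      Glue Γ ⟨⟨v, k, l, h⟩, (s, 0)⟩ ⟨⟨v, k, l', h'⟩, (s, 0)⟩
  /-- At the middle of an edge of colour `c` the three sheets coming from one end are attached to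
  the three sheets coming from the other end. Seen along a direction of travel, position `p`
  outwards at the starting end is position `p`, and position `p'` outwards at the arrival end is
  position `-p'` (clockwise and counterclockwise are exchanged when the direction is reversed).
  Colour `0` matches vertical sheets with vertical sheets, and colour `c` adds `c` thirds of a
  full clockwise turn: `-p' = p + c`. -/
  | edge (v v' : V) (k l k' l' : Fin 4) (h : k ≠ l) (h' : k' ≠ l')
      (hmate : Γ.mate (v, k) = (v', k'))
      (hpos : -sheetPosition k' l' = sheetPosition k l + Γ.colour (v, k)) (t : I) :
      Glue Γ ⟨⟨v, k, l, h⟩, (1, t)⟩ ⟨⟨v', k', l', h'⟩, (1, t)⟩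

/-- The standard polyhedron defined by an o-graph, with the quotient topology. -/
abbrev Polyhedron (Γ : OGraph V) : Type := Quot Γ.Glue

/-- The singular set of the polyhedron: the four-valent graph consisting of all the edges. -/
def singularSet (Γ : OGraph V) : Set Γ.Polyhedron :=
  {x | ∃ (p : Sector V) (s : I), x = Quot.mk Γ.Glue ⟨p, (s, 0)⟩}

/-- The faces of the polyhedron: the connected components of the complement of the singular
set. -/
abbrev Face (Γ : OGraph V) : Type := ConnectedComponents ↥(Γ.singularSetᶜ)

end OGraph

/-- The closed chain with vertices `v_0, …, v_{n-1}` in cyclic order, drawn along an annulus as a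
closed two-strand braid with `n` crossings of the same sign. At each crossing the edge-ends `0`, `1`
point to the previous vertex and `3`, `2` to the following one; `0`, `3` are the ends on
one side of the chain and `1`, `2` are those on the other side. The vertices `v_i` and `v_{i+1}` are
joined by an edge with colour `(c i).1` on the first side and by an edge with colour `(c i).2` on
the second side. -/
def closedChain (n : ℕ) [NeZero n] (c : Fin n → ZMod 3 × ZMod 3) : OGraph (Fin n) where
  mate h := match h with
    | (v, 0) => (v - 1, 3)
    | (v, 1) => (v - 1, 2)
    | (v, 2) => (v + 1, 1)
    | (v, 3) => (v + 1, 0)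
  mate_mate h := by
    obtain ⟨v, k⟩ := h
    fin_cases k <;> simp
  mate_ne h := by
    obtain ⟨v, k⟩ := h
    fin_cases k <;> simp
  colour h := match h with
    | (v, 0) => (c (v - 1)).1
    | (v, 1) => (c (v - 1)).2
    | (v, 2) => (c v).2
    | (v, 3) => (c v).1
  colour_mate h := by
    obtain ⟨v, k⟩ := h
    fin_cases k <;> simp

/-- The alphabet of the random word. -/
def chainLetters : Finset (ZMod 3 × ZMod 3) := {(0, 2), (1, 2), (2, 0), (2, 1)}

instance : Nonempty ↥chainLetters := ⟨⟨(0, 2), by decide⟩⟩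

/-! ### Faces as gluing classes of sectors -/

namespace OGraph

variable {V : Type}

/-! A face is a class of sectors glued along edges, so there is one face iff every gluing-invariant
`Bool`-valued function on sectors is constant (`card_face_eq_one_iff`). At a vertex of the chain
four sectors cross from the previous block to the next; `{0, 1}` and `{2, 3}` meet one block each.
Along an edge of the chain, `{2, 3}` is glued to the next `{0, 1}` exactly when the colour is 2. A
letter has one colour 2, so its block permutes the four crossing strands (`compatible_letter_iff`).
The block `(a, b)` has none, and turns back two strands on each side (`compatible_closing_iff`).
Hence the number of faces being one depends only on the product of the letter permutations
(`chain_card_face_eq_one_iff`). Whatever comes before, exactly 8 of the 16 two-letter endings give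
one face (`sum_unifies`), hence probability exactly 1/2. -/

/-- A function on sectors which does not depend on the order of the two sides and agrees on
sectors glued along the middle of an edge. -/
structure IsFaceColouring (Γ : OGraph V) (f : Sector V → Bool) : Prop where
  swap : ∀ (v : V) (k l : Fin 4) (h : k ≠ l), f ⟨v, k, l, h⟩ = f ⟨v, l, k, h.symm⟩
  edge : ∀ (v v' : V) (k l k' l' : Fin 4) (h : k ≠ l) (h' : k' ≠ l'),
    Γ.mate (v, k) = (v', k') →
    -sheetPosition k' l' = sheetPosition k l + Γ.colour (v, k) →
    f ⟨v, k, l, h⟩ = f ⟨v', k', l', h'⟩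

/-- A point of a sector, off the two sides lying in the singular set, in a sector satisfying `P`. -/
def inSector (P : Sector V → Prop) (x : Pieces V) : Prop :=
  P x.1 ∧ x.2.1 ≠ 0 ∧ x.2.2 ≠ 0

/-- Half-edge gluings need no hypothesis on `P`: they only involve points with a zero coordinate,
where `inSector` fails. Equality of propositions is the form required by `Quot.lift`. -/
lemma inSector_glue (Γ : OGraph V) {P : Sector V → Prop}
    (swap : ∀ (v : V) (k l : Fin 4) (h : k ≠ l), P ⟨v, k, l, h⟩ ↔ P ⟨v, l, k, h.symm⟩)
    (edge : ∀ (v v' : V) (k l k' l' : Fin 4) (h : k ≠ l) (h' : k' ≠ l'),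
      Γ.mate (v, k) = (v', k') →
      -sheetPosition k' l' = sheetPosition k l + Γ.colour (v, k) →
      (P ⟨v, k, l, h⟩ ↔ P ⟨v', k', l', h'⟩))
    {x y : Pieces V} (h : Γ.Glue x y) : inSector P x = inSector P y := by
  apply propext
  cases h with
  | swap v k l h s t =>
    have := swap v k l h
    simp only [inSector]
    tauto
  | halfEdge v k l l' h h' s => simp [inSector]
  | edge v v' k l k' l' h h' hm hp t =>
    have := edge v v' k l k' l' h h' hm hp
    simp only [inSector]
    tauto

lemma isOpen_inSector (P : Sector V → Prop) : IsOpen {x : Pieces V | inSector P x} := by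
  rw [isOpen_sigma_iff]
  intro p
  by_cases hp : P p
  · have : Sigma.mk p ⁻¹' {x : Pieces V | inSector P x} =
        {q : I × I | q.1 ≠ 0} ∩ {q : I × I | q.2 ≠ 0} := by
      ext q; simp [inSector, hp]
    rw [this]
    exact (isOpen_ne_fun continuous_fst continuous_const).inter
      (isOpen_ne_fun continuous_snd continuous_const)
  · have : Sigma.mk p ⁻¹' {x : Pieces V | inSector P x} = ∅ := by
      ext q; simp [inSector, hp]
    rw [this]
    exact isOpen_empty

lemma mk_mem_singularSet_iff (Γ : OGraph V) (x : Pieces V) :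
    Quot.mk Γ.Glue x ∈ Γ.singularSet ↔ x.2.1 = 0 ∨ x.2.2 = 0 := by
  constructor
  · rintro ⟨p, s, h⟩
    have := congrArg (Quot.lift (inSector fun _ : Sector V => True)
      fun _ _ => inSector_glue Γ (by simp) (by simp)) h
    simp only [inSector] at this
    simp only [true_and, ne_eq, not_true_eq_false, and_false, eq_iff_iff, iff_false] at this
    tauto
  · obtain ⟨⟨v, k, l, hkl⟩, s, t⟩ := x
    rintro (h | h)
    · simp only at h
      subst h
      exact ⟨⟨v, l, k, hkl.symm⟩, t, Quot.sound (Glue.swap v k l hkl 0 t)⟩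
    · simp only at h
      subst h
      exact ⟨⟨v, k, l, hkl⟩, s, rfl⟩

lemma isPreconnected_open_square :
    IsPreconnected {q : I × I | q.1 ≠ 0 ∧ q.2 ≠ 0} := by
  have h : IsPreconnected {s : I | s ≠ 0} := by
    have : {s : I | s ≠ 0} = Set.Ioi 0 := by
      ext s; simp [unitInterval.pos_iff_ne_zero]
    rw [this]
    exact isPreconnected_Ioi
  exact h.prod h

/-- The part of a sector lying off the singular set. -/
def openSector (Γ : OGraph V) (p : Sector V) : Set Γ.Polyhedron :=
  (fun q => Quot.mk Γ.Glue ⟨p, q⟩) '' {q : I × I | q.1 ≠ 0 ∧ q.2 ≠ 0}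

lemma isPreconnected_openSector (Γ : OGraph V) (p : Sector V) :
    IsPreconnected (Γ.openSector p) := by
  refine isPreconnected_open_square.image _ (Continuous.continuousOn ?_)
  exact continuous_quot_mk.comp continuous_sigmaMk

lemma openSector_subset (Γ : OGraph V) (p : Sector V) : Γ.openSector p ⊆ Γ.singularSetᶜ := by
  rintro _ ⟨q, hq, rfl⟩ h
  rw [mk_mem_singularSet_iff] at h
  exact h.elim hq.1 hq.2

/-- The centre of the face containing a given sector. -/
def centre (Γ : OGraph V) (p : Sector V) : Γ.Polyhedron := Quot.mk _ ⟨p, (1, 1)⟩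

lemma centre_mem (Γ : OGraph V) (p : Sector V) : Γ.centre p ∈ Γ.openSector p :=
  ⟨(1, 1), by simp, rfl⟩

/-- A nonconstant colouring separates the complement into two open sets; conversely, membership of
the sector centres in one component is a colouring, and each open sector is connected. -/
lemma isPreconnected_compl_singularSet_iff (Γ : OGraph V) :
    IsPreconnected Γ.singularSetᶜ ↔
      ∀ f, Γ.IsFaceColouring f → ∀ p q : Sector V, f p = f q := by
  classical
  constructor
  · intro hc f hf p q
    let U (b : Bool) : Set Γ.Polyhedron := {x | Quot.lift (inSector fun p : Sector V => f p = b)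
      (fun _ _ => inSector_glue Γ (fun v k l h => by rw [hf.swap v k l h])
        (fun v v' k l k' l' h h' hm hp => by rw [hf.edge v v' k l k' l' h h' hm hp])) x}
    have hU (b : Bool) : IsOpen (U b) := by
      rw [← isQuotientMap_quot_mk.isOpen_preimage]
      exact isOpen_inSector fun p : Sector V => f p = b
    by_contra hpq
    have hmem (r : Sector V) : Γ.centre r ∈ U (f r) := by
      change inSector (fun p : Sector V => f p = f r) ⟨r, (1, 1)⟩
      simp [inSector]
    obtain ⟨x, -, h1, h2⟩ := hc (U (f p)) (U (f q)) (hU _) (hU _)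
      (by
        intro x hx
        induction x using Quot.ind with
        | mk x =>
          have h0 : ¬ (x.2.1 = 0 ∨ x.2.2 = 0) := (mk_mem_singularSet_iff Γ x).not.1 hx
          have : f x.1 = f p ∨ f x.1 = f q := by
            revert hpq
            cases f x.1 <;> cases f p <;> cases f q <;> simp
          rcases this with h | h
          · exact Or.inl ⟨h, by tauto, by tauto⟩
          · exact Or.inr ⟨h, by tauto, by tauto⟩)
      ⟨_, Γ.openSector_subset p (Γ.centre_mem p), hmem p⟩
      ⟨_, Γ.openSector_subset q (Γ.centre_mem q), hmem q⟩
    induction x using Quot.ind with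
    | mk x => exact hpq (h1.1.symm.trans h2.1)
  · intro H
    rcases isEmpty_or_nonempty (Sector V) with he | ⟨⟨p₀⟩⟩
    · intro u v _ _ _ ⟨x, _⟩
      induction x using Quot.ind with
      | mk x => exact he.elim x.1
    · have hcol : Γ.IsFaceColouring fun p =>
          decide (Γ.centre p ∈ connectedComponentIn Γ.singularSetᶜ (Γ.centre p₀)) := by
        constructor
        · intro v k l h
          rw [show Γ.centre ⟨v, k, l, h⟩ = Γ.centre ⟨v, l, k, h.symm⟩ from
            Quot.sound (Glue.swap v k l h 1 1)]
        · intro v v' k l k' l' h h' hm hp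
          rw [show Γ.centre ⟨v, k, l, h⟩ = Γ.centre ⟨v', k', l', h'⟩ from
            Quot.sound (Glue.edge v v' k l k' l' h h' hm hp 1)]
      have hall (p : Sector V) :
          Γ.centre p ∈ connectedComponentIn Γ.singularSetᶜ (Γ.centre p₀) := by
        have := H _ hcol p p₀
        rw [decide_eq_decide] at this
        exact this.2 (mem_connectedComponentIn (Γ.openSector_subset p₀ (Γ.centre_mem p₀)))
      have : Γ.singularSetᶜ = connectedComponentIn Γ.singularSetᶜ (Γ.centre p₀) := by
        refine Set.Subset.antisymm (fun x hx => ?_) (connectedComponentIn_subset _ _)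
        induction x using Quot.ind with
        | mk x =>
          have h0 : ¬ (x.2.1 = 0 ∨ x.2.2 = 0) := (mk_mem_singularSet_iff Γ x).not.1 hx
          rw [connectedComponentIn_eq (hall x.1)]
          exact (Γ.isPreconnected_openSector x.1).subset_connectedComponentIn
            (Γ.centre_mem x.1) (Γ.openSector_subset x.1) ⟨x.2, by simpa using h0, rfl⟩
      rw [this]
      exact isPreconnected_connectedComponentIn

lemma _root_.subsingleton_connectedComponents_iff {X : Type*} [TopologicalSpace X] :
    Subsingleton (ConnectedComponents X) ↔ PreconnectedSpace X := by
  refine ⟨fun h => ?_, fun h => inferInstance⟩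
  rw [preconnectedSpace_iff_connectedComponent]
  intro x
  refine Set.eq_univ_of_forall fun y => ?_
  rw [← ConnectedComponents.coe_eq_coe']
  exact Subsingleton.elim _ _

lemma card_face_eq_one_iff [Nonempty V] (Γ : OGraph V) :
    Nat.card Γ.Face = 1 ↔ ∀ f, Γ.IsFaceColouring f → ∀ p q : Sector V, f p = f q := by
  have : Nonempty Γ.Face := by
    obtain ⟨v⟩ := ‹Nonempty V›
    exact ⟨ConnectedComponents.mk ⟨_, Γ.openSector_subset _ (Γ.centre_mem ⟨v, 0, 1, by decide⟩)⟩⟩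
  rw [← isPreconnected_compl_singularSet_iff, isPreconnected_iff_preconnectedSpace,
    ← subsingleton_connectedComponents_iff, Nat.card_eq_one_iff_unique]
  exact and_iff_left this

end OGraph
-- Face colourings of a chain as tables
/-- The symmetric table of the values of a function on the six sectors at a vertex of a chain: `x`
lists the values on the sectors `{0, 2}`, `{0, 3}`, `{1, 2}`, `{1, 3}`, while `L` and `R` are the
values on `{0, 1}` and `{2, 3}`. -/
def sectorTable (x : Fin 4 → Bool) (L R : Bool) : Fin 4 → Fin 4 → Bool :=
  ![![false, L, x 0, x 1], ![L, false, x 2, x 3], ![x 0, x 2, false, R], ![x 1, x 3, R, false]]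

/-- Compatibility of functions on the sectors at two consecutive vertices of a chain along the
two edges joining these vertices. -/
def Compatible (c : ZMod 3 × ZMod 3) (M M' : Fin 4 → Fin 4 → Bool) : Prop :=
  (∀ l l', 3 ≠ l → 0 ≠ l' → -sheetPosition 0 l' = sheetPosition 3 l + c.1 → M 3 l = M' 0 l') ∧
  (∀ l l', 2 ≠ l → 1 ≠ l' → -sheetPosition 1 l' = sheetPosition 2 l + c.2 → M 2 l = M' 1 l')

lemma sectorTable_symm (x : Fin 4 → Bool) (L R : Bool) (k l : Fin 4) :
    sectorTable x L R k l = sectorTable x L R l k := by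
  fin_cases k <;> fin_cases l <;> rfl

lemma sectorTable_const (b : Bool) (k l : Fin 4) (h : k ≠ l) :
    sectorTable (fun _ => b) b b k l = b := by
  fin_cases k <;> fin_cases l <;> first | rfl | exact absurd rfl h

/-- The functions on the sectors of a closed chain are encoded by their tables. -/
lemma closedChain_card_face_eq_one_iff (n : ℕ) [NeZero n] (c : Fin n → ZMod 3 × ZMod 3) :
    Nat.card (closedChain n c).Face = 1 ↔
      ∀ (x : Fin n → Fin 4 → Bool) (L R : Fin n → Bool),
        (∀ v, Compatible (c v) (sectorTable (x v) (L v) (R v))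
          (sectorTable (x (v + 1)) (L (v + 1)) (R (v + 1)))) →
        ∃ b, ∀ v, x v = (fun _ => b) ∧ L v = b ∧ R v = b := by
  rw [OGraph.card_face_eq_one_iff]
  constructor
  · intro H x L R hc
    have hf : (closedChain n c).IsFaceColouring
        fun p => sectorTable (x p.vertex) (L p.vertex) (R p.vertex) p.fst p.snd := by
      constructor
      · intro v k l h
        exact sectorTable_symm _ _ _ _ _
      · intro v v' k l k' l' h h' hm hp
        dsimp only
        fin_cases k
        -- Ends `0` and `1` lead backwards; the condition `-p' = p + c` is symmetric in `p` and
        -- `p'`, so the edge can be read from its other end.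
        · obtain ⟨rfl, rfl⟩ : v - 1 = v' ∧ 3 = k' := Prod.mk.inj hm
          have hp' : -sheetPosition 3 l' = sheetPosition 0 l + (c (v - 1)).1 := hp
          have := (hc (v - 1)).1 l' l h' h (by linear_combination hp')
          simpa using this.symm
        · obtain ⟨rfl, rfl⟩ : v - 1 = v' ∧ 2 = k' := Prod.mk.inj hm
          have hp' : -sheetPosition 2 l' = sheetPosition 1 l + (c (v - 1)).2 := hp
          have := (hc (v - 1)).2 l' l h' h (by linear_combination hp')
          simpa using this.symm
        · obtain ⟨rfl, rfl⟩ : v + 1 = v' ∧ 1 = k' := Prod.mk.inj hm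
          exact (hc v).2 l l' h h' hp
        · obtain ⟨rfl, rfl⟩ : v + 1 = v' ∧ 0 = k' := Prod.mk.inj hm
          exact (hc v).1 l l' h h' hp
    have key := H _ hf ⟨0, 0, 1, by decide⟩
    refine ⟨L 0, fun v => ⟨funext fun i => ?_, ?_, ?_⟩⟩
    · fin_cases i
      · exact (key ⟨v, 0, 2, by decide⟩).symm
      · exact (key ⟨v, 0, 3, by decide⟩).symm
      · exact (key ⟨v, 1, 2, by decide⟩).symm
      · exact (key ⟨v, 1, 3, by decide⟩).symm
    · exact (key ⟨v, 0, 1, by decide⟩).symm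
    · exact (key ⟨v, 2, 3, by decide⟩).symm
  · intro H f hf
    -- The dummy diagonal value `false` is the one used in `sectorTable`.
    let T (v : Fin n) (k l : Fin 4) : Bool := if h : k ≠ l then f ⟨v, k, l, h⟩ else false
    have hT (v : Fin n) : T v = sectorTable ![T v 0 2, T v 0 3, T v 1 2, T v 1 3] (T v 0 1)
        (T v 2 3) := by
      have hs (k l : Fin 4) : T v k l = T v l k := by
        by_cases h : k = l
        · rw [h]
        · simp only [T, ne_eq, h, Ne.symm h, not_false_eq_true, dif_pos]
          exact hf.swap v k l h
      funext k l
      fin_cases k <;> fin_cases l <;> first | rfl | exact hs _ _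
    have hfT (p : Sector (Fin n)) : f p = T p.vertex p.fst p.snd := by
      simp only [T, p.ne, dif_pos, ne_eq, not_false_eq_true]
    obtain ⟨b, hb⟩ := H (fun v => ![T v 0 2, T v 0 3, T v 1 2, T v 1 3]) (fun v => T v 0 1)
      (fun v => T v 2 3) (by
        intro v
        rw [← hT, ← hT]
        constructor
        · intro l l' h h' hp
          simp only [T, dif_pos h, dif_pos h']
          exact hf.edge v (v + 1) 3 l 0 l' h h' rfl hp
        · intro l l' h h' hp
          simp only [T, dif_pos h, dif_pos h']
          exact hf.edge v (v + 1) 2 l 1 l' h h' rfl hp)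
    have hfb (p : Sector (Fin n)) : f p = b := by
      rw [hfT, hT, (hb p.vertex).1, (hb p.vertex).2.1, (hb p.vertex).2.2]
      exact sectorTable_const _ _ _ p.ne
    intro p q
    rw [hfb, hfb]

/-! ### Transfer across a block -/

/-- The permutation of the four sectors joining both sides of the chain induced by a letter. -/
def letterPerm (c : ZMod 3 × ZMod 3) : Equiv.Perm (Fin 4) :=
  if c.2 = 2 then ⟨![3, 1, 0, 2], ![2, 1, 3, 0], by decide, by decide⟩
  else ⟨![1, 3, 2, 0], ![3, 0, 2, 1], by decide, by decide⟩

/-- The sector, among the four joining both sides of the chain at the second vertex of a block,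
which lies in the same face as the two remaining sectors meeting the block. -/
def capIndex (c : ZMod 3 × ZMod 3) : Fin 4 :=
  if c = (0, 2) then 1 else if c = (1, 2) then 0 else if c = (2, 0) then 2 else 3

/-- Sectors `R` and `L'` are glued to each other along the edge of colour 2, and along the other
edge each is glued to a crossing sector: both are intermediate pieces of one of the four strands. -/
lemma compatible_letter_iff {c : ZMod 3 × ZMod 3} (hc : c ∈ chainLetters)
    (x y : Fin 4 → Bool) (L R L' R' : Bool) :
    Compatible c (sectorTable x L R) (sectorTable y L' R') ↔
      y = x ∘ letterPerm c ∧ R = y (capIndex c) ∧ L' = y (capIndex c) := by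
  simp only [chainLetters, Finset.mem_insert, Finset.mem_singleton] at hc
  rw [funext_iff]
  rcases hc with rfl | rfl | rfl | rfl <;>
    simp +decide [Compatible, sectorTable, Fin.forall_fin_succ, letterPerm, capIndex,
      sheetPosition] <;>
    grind

/-- Compatibility along a block whose two colours `a`, `b` belong to `{0, 1}`, in terms of the
sectors joining both sides of the chain. -/
def Closing (a b : ZMod 3) (x y : Fin 4 → Bool) : Prop :=
  (x (if a = 0 then 1 else 3) = x (if b = 0 then 2 else 0)) ∧
  (y (if a = 0 then 1 else 0) = y (if b = 0 then 2 else 3)) ∧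
  (if a = 0 then x 3 = y 0 else x 1 = y 1) ∧ (if b = 0 then x 0 = y 3 else x 2 = y 2)

instance (a b : ZMod 3) (x y : Fin 4 → Bool) : Decidable (Closing a b x y) := by
  unfold Closing; infer_instance

/-- Without colour 2, `R` joins two crossing sectors of `y` and `L'` joins two of `x`; the two
remaining gluings link `x` to `y`. -/
lemma compatible_closing_iff {a b : ZMod 3} (ha : a = 0 ∨ a = 1) (hb : b = 0 ∨ b = 1)
    (x y : Fin 4 → Bool) (L R L' R' : Bool) :
    Compatible (a, b) (sectorTable x L R) (sectorTable y L' R') ↔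
      Closing a b x y ∧ R = y (if a = 0 then 1 else 0) ∧ L' = x (if a = 0 then 1 else 3) := by
  rcases ha with rfl | rfl <;> rcases hb with rfl | rfl <;>
    simp +decide [Compatible, sectorTable, Fin.forall_fin_succ, Closing, sheetPosition] <;>
    grind

/-- The strands of a closed chain form a single face when its block of colours `a`, `b` is
complemented by blocks with total permutation `τ`. -/
def Unifies (a b : ZMod 3) (τ : Equiv.Perm (Fin 4)) : Prop :=
  ∀ g : Fin 4 → Bool, Closing a b (g ∘ τ) g → ∀ i, g i = g 0

instance (a b : ZMod 3) (τ : Equiv.Perm (Fin 4)) : Decidable (Unifies a b τ) := by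
  unfold Unifies; infer_instance

/-- The total permutation of a word. -/
def wordPerm {m : ℕ} (w : Fin m → ↥chainLetters) : Equiv.Perm (Fin 4) :=
  Fin.partialProd (fun i => letterPerm (w i)) (Fin.last m)

/-- The letter blocks propagate the values `g` at vertex `0 + 1` around the chain to `g ∘ wordPerm
w` at vertex `0`; only block `0` then constrains `g`. -/
lemma chain_card_face_eq_one_iff {a b : ZMod 3} (ha : a = 0 ∨ a = 1) (hb : b = 0 ∨ b = 1)
    {m : ℕ} (w : Fin m → ↥chainLetters) :
    Nat.card (closedChain (m + 1) (Fin.cons (a, b) fun i => (w i : ZMod 3 × ZMod 3))).Face = 1 ↔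
      Unifies a b (wordPerm w) := by
  rw [closedChain_card_face_eq_one_iff]
  set π := Fin.partialProd (fun i => letterPerm (w i)) with hπ
  have hlast : Fin.last m + 1 = 0 := Fin.last_add_one m
  have hsucc (i : Fin m) : i.castSucc + 1 = i.succ := Fin.coeSucc_eq_succ
  constructor
  · intro H g hg
    let x (v : Fin (m + 1)) : Fin 4 → Bool := g ∘ π (v - 1)
    -- Common value of `R` at `u` and `L` at `u + 1`; in block `0` these two may differ, so the
    -- value there is passed as `d`.
    let cap (u : Fin (m + 1)) (d : Bool) : Bool :=
      Fin.cases d (fun i => x (i.succ + 1) (capIndex (w i))) u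
    have hx0 : x 0 = g ∘ wordPerm w := by
      simp only [x, wordPerm, ← hlast, add_sub_cancel_right, hπ]
    have hx1 : x (0 + 1) = g := by
      simp only [x, add_sub_cancel_right, hπ, Fin.partialProd_zero]
      rfl
    obtain ⟨b', hb'⟩ := H x (fun v => cap (v - 1) (x 0 (if a = 0 then 1 else 3)))
      (fun v => cap v (g (if a = 0 then 1 else 0))) (by
        intro v
        induction v using Fin.cases with
        | zero =>
          rw [Fin.cons_zero, compatible_closing_iff ha hb, hx1, hx0]
          refine ⟨hg, rfl, ?_⟩
          rw [add_sub_cancel_right]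
          rfl
        | succ i =>
          rw [Fin.cons_succ, compatible_letter_iff (w i).2]
          refine ⟨?_, rfl, ?_⟩
          · simp only [x, add_sub_cancel_right, hπ, Fin.partialProd_succ]
            rw [← hsucc, add_sub_cancel_right]
            rfl
          · simp only [add_sub_cancel_right]
            rfl)
    have := (hb' (0 + 1)).1
    rw [hx1] at this
    intro i
    rw [this]
  · intro H x L R hc
    have h0 := (compatible_closing_iff ha hb _ _ _ _ _ _).1 (Fin.cons_zero (α := fun _ => ZMod 3 × ZMod 3) (a, b) _ ▸ hc 0)
    have hs (i : Fin m) := (compatible_letter_iff (w i).2 _ _ _ _ _ _).1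
      (by simpa only [Fin.cons_succ] using hc i.succ)
    have hx (u : Fin (m + 1)) : x (u + 1) = x (0 + 1) ∘ π u := by
      induction u using Fin.induction with
      | zero => simp only [hπ, Fin.partialProd_zero]; rfl
      | succ i ih =>
        rw [(hs i).1, ← hsucc, ih, hsucc, hπ, Fin.partialProd_succ]
        rfl
    have hx0 : x 0 = x (0 + 1) ∘ wordPerm w := by
      rw [← hlast, hx, hlast]; rfl
    have hconst := H (x (0 + 1)) (hx0 ▸ h0.1)
    have hall (v : Fin (m + 1)) : x v = fun _ => x (0 + 1) 0 := by
      funext i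
      rw [← sub_add_cancel v 1, hx]
      exact hconst _
    refine ⟨x (0 + 1) 0, fun v => ⟨hall v, ?_, ?_⟩⟩
    -- `L v` is determined by the block preceding `v`.
    · rw [← sub_add_cancel v 1]
      induction v - 1 using Fin.cases with
      | zero => rw [h0.2.2, hall 0]
      | succ i => rw [(hs i).2.2, hall]
    · induction v using Fin.cases with
      | zero => exact h0.2.1.trans (by rw [hall (0 + 1)])
      | succ i => rw [(hs i).2.1, hall]

lemma wordPerm_cons {m : ℕ} (d : ↥chainLetters) (w : Fin m → ↥chainLetters) :
    wordPerm (Fin.cons d w : Fin (m + 1) → ↥chainLetters) = letterPerm d * wordPerm w := by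
  rw [wordPerm, ← Fin.succ_last, Fin.partialProd_succ']
  rfl

/-! ### Counting words -/

/-- The number of words of length `m` which, preceded by blocks with total permutation `τ`, give a
single face. -/
def unifyingCount (a b : ZMod 3) (m : ℕ) (τ : Equiv.Perm (Fin 4)) : ℕ :=
  ∑ w : Fin m → ↥chainLetters, if Unifies a b (τ * wordPerm w) then 1 else 0

lemma unifyingCount_zero (a b : ZMod 3) (τ : Equiv.Perm (Fin 4)) :
    unifyingCount a b 0 τ = if Unifies a b τ then 1 else 0 := by
  simp [unifyingCount, wordPerm]

lemma unifyingCount_succ (a b : ZMod 3) (m : ℕ) (τ : Equiv.Perm (Fin 4)) :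
    unifyingCount a b (m + 1) τ =
      ∑ d : ↥chainLetters, unifyingCount a b m (τ * letterPerm d) := by
  unfold unifyingCount
  rw [← (Fin.consEquiv fun _ : Fin (m + 1) => ↥chainLetters).sum_comp, Fintype.sum_prod_type]
  refine Finset.sum_congr rfl fun d _ => Finset.sum_congr rfl fun w _ => ?_
  rw [mul_assoc, ← wordPerm_cons]
  rfl

/-- Checked by enumeration. Conceptually, the letters give two 3-cycles `p`, `q`, twice each, and
`pp`, `pq`, `qp`, `qq` fill a coset of the Klein four-group, of which half unify after any `τ`.
Indeed, if a permutation sends the turned-back pair of `x` to that of `y` or to its complement, it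
unifies just in the latter case; otherwise precomposing with the swap inside that pair and inside
its complement toggles `Unifies`. -/
lemma sum_unifies {a b : ZMod 3} (ha : a = 0 ∨ a = 1) (hb : b = 0 ∨ b = 1)
    (τ : Equiv.Perm (Fin 4)) :
    (∑ d : ↥chainLetters, ∑ e : ↥chainLetters,
      if Unifies a b (τ * letterPerm d * letterPerm e) then 1 else 0) = 8 := by
  have key : ∀ τ : Equiv.Perm (Fin 4), ∀ a ∈ ({0, 1} : Finset (ZMod 3)),
      ∀ b ∈ ({0, 1} : Finset (ZMod 3)), (∑ d : ↥chainLetters, ∑ e : ↥chainLetters,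
      if Unifies a b (τ * letterPerm d * letterPerm e) then 1 else 0) = 8 := by
    decide +kernel
  exact key τ a (by simpa using ha) b (by simpa using hb)

/-- Letting the prefix `τ` vary makes the induction work: the first letter is absorbed into `τ`. -/
lemma unifyingCount_add_two {a b : ZMod 3} (ha : a = 0 ∨ a = 1) (hb : b = 0 ∨ b = 1) (m : ℕ)
    (τ : Equiv.Perm (Fin 4)) : 2 * unifyingCount a b (m + 2) τ = 4 ^ (m + 2) := by
  induction m generalizing τ with
  | zero =>
    simp only [unifyingCount_succ, unifyingCount_zero]
    rw [sum_unifies ha hb]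
    rfl
  | succ m ih =>
    rw [unifyingCount_succ, Finset.mul_sum]
    simp only [ih]
    rw [Finset.sum_const, Finset.card_univ, Fintype.card_coe, show chainLetters.card = 4 from rfl]
    ring

/-- The closed chain has `n = m + 1` vertices; `w` is a uniformly random word of length `n - 1`. -/
theorem proposition2p8 (a b : ZMod 3) (ha : a = 0 ∨ a = 1) (hb : b = 0 ∨ b = 1) :
    ∃ N : ℕ, ∀ m : ℕ, N ≤ m + 1 →
      (PMF.uniformOfFintype (Fin m → ↥chainLetters)).toOuterMeasure
        {w | Nat.card (closedChain (m + 1)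
          (Fin.cons (a, b) fun i => (w i : ZMod 3 × ZMod 3))).Face = 1} = 1 / 2 := by
  classical
  -- Three vertices leave the two random letters needed by `sum_unifies`.
  refine ⟨3, fun m hm => ?_⟩
  obtain ⟨m, rfl⟩ : ∃ k, m = k + 2 := ⟨m - 2, by omega⟩
  rw [PMF.toOuterMeasure_uniformOfFintype_apply]
  simp only [chain_card_face_eq_one_iff ha hb]
  have h1 := unifyingCount_add_two ha hb m 1
  have h2 : Fintype.card {w : Fin (m + 2) → ↥chainLetters | Unifies a b (wordPerm w)} =
      unifyingCount a b (m + 2) 1 := by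
    rw [unifyingCount, ← Finset.card_filter, Fintype.card_subtype]
    simp
  have h3 : Fintype.card (Fin (m + 2) → ↥chainLetters) = 2 * unifyingCount a b (m + 2) 1 := by
    rw [h1, Fintype.card_fun, Fintype.card_coe, Fintype.card_fin]
    rfl
  have h4 : (unifyingCount a b (m + 2) 1 : ENNReal) ≠ 0 := by
    intro h
    rw [Nat.cast_eq_zero.1 h] at h1
    exact absurd h1.symm (by positivity)
  rw [h2, h3, Nat.cast_mul, Nat.cast_ofNat, ENNReal.div_eq_inv_mul,
    ENNReal.mul_inv (by simp) (by simp), mul_assoc,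
    ENNReal.inv_mul_cancel h4 (ENNReal.natCast_ne_top _), mul_one, one_div]
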